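/- For a finite poset $P$ and $i\ge 0$ let $\#N_i(P)$ be the number of weakly increasing sequences $x_0\le x_1\le\dots\le x_i$ in $P$, and let $\#\overline{N_i}(P)$ be the number of strictly increasing sequences $x_0<x_1<\dots<x_i$ in $P$. The dimension $\dim P$ is the greatest $i$ with $\#\overline{N_i}(P)\ne 0$, the Euler characteristic is $\chi(P)=\sum_{i=0}^{\dim P}(-1)^i\,\#\overline{N_i}(P)$, and the zeta series of $P$ is $Z_P(s)=\sum_{i\ge 0}\#N_i(P)\,s^i$; it is the expansion at $0$ of a unique rational function of the complex variable $s$, which is also denoted by $Z_P(s)$. The barycentric subdivision $\mathrm{Sd}(P)$ is the poset of nonempty totally ordered subsets of $P$, ordered by inclusion, and $\mathrm{Sd}^k$ is its $k$-fold iterate. **Theorem.** Let $P$ be a finite poset of dimension $d\ge 1$ with $\chi(P)\neq 0$. Then for every $k\ge 0$ the rational function $Z_{\mathrm{Sd}^k(P)}(s)$ has exactly $d$ complex zeros, counted with multiplicity. For each $k$ let $\beta_1^{(k)},\dots,\beta_d^{(k)}$ be these zeros, listed with multiplicity in any order such that $|\beta_1^{(k)}|=\max_{1\le i\le d}|\beta_i^{(k)}|$.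 Then, as $k\to\infty$: 1. $|\beta_1^{(k)}|\to\infty$; 2. the other zeros converge: after a suitable reordering of $\beta_2^{(k)},\dots,\beta_d^{(k)}$ for each $k$, the sequence $(\beta_i^{(k)})_k$ converges in $\mathbb{C}$ for every $2\le i\le d$; 3. $\beta_1^{(k)}$ is real for all sufficiently large $k$; 4. $\prod_{i=2}^{d}\beta_i^{(k)}\to(-1)^{d-1}$. -/

import Mathlib

open Filter Topology

/-- `#N_i(P)`: the number of chains of morphisms `x₀ → x₁ → ⋯ → x_i` of length `i` in the poset
`P`, identity morphisms being allowed; that is, the number of weakly increasing sequences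
`x₀ ≤ x₁ ≤ ⋯ ≤ x_i`. -/
noncomputable def numChains (P : Type*) [PartialOrder P] (i : ℕ) : ℕ :=
  Nat.card {x : Fin (i + 1) → P // Monotone x}

/-- The number of chains of nonidentity morphisms of length `i` in the poset `P`; that is, the
number of strictly increasing sequences `x₀ < x₁ < ⋯ < x_i`. -/
noncomputable def numStrictChains (P : Type*) [PartialOrder P] (i : ℕ) : ℕ :=
  Nat.card {x : Fin (i + 1) → P // StrictMono x}

/-- The dimension of a finite poset: the greatest `i` for which there is a chain of nonidentity
morphisms of length `i` (and `0` for the empty poset). -/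
noncomputable def posetDim (P : Type*) [PartialOrder P] : ℕ :=
  sSup {i : ℕ | numStrictChains P i ≠ 0}

/-- For a nonempty finite poset the dimension is the greatest length of a strict chain. -/
theorem isGreatest_posetDim (P : Type*) [PartialOrder P] [Finite P] [Nonempty P] :
    IsGreatest {i : ℕ | numStrictChains P i ≠ 0} (posetDim P) := by
  have hb : BddAbove {i : ℕ | numStrictChains P i ≠ 0} := by
    refine ⟨Nat.card P, fun i hi => ?_⟩
    obtain ⟨⟨x, hx⟩⟩ : Nonempty {x : Fin (i + 1) → P // StrictMono x} := by
      by_contra h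
      rw [not_nonempty_iff] at h
      exact hi Nat.card_of_isEmpty
    have := Nat.card_le_card_of_injective x hx.injective
    simp only [Nat.card_fin] at this
    omega
  refine ⟨Nat.sSup_mem ⟨0, ?_⟩ hb, fun i hi => le_csSup hb hi⟩
  obtain ⟨p⟩ := ‹Nonempty P›
  have : Nonempty {x : Fin (0 + 1) → P // StrictMono x} :=
    ⟨⟨fun _ => p, fun a b h => absurd h (by omega)⟩⟩
  exact Nat.card_pos.ne'

/-- The Euler characteristic of a finite poset. -/
noncomputable def eulerChar (P : Type*) [PartialOrder P] : ℤ :=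
  ∑ i ∈ Finset.range (posetDim P + 1), (-1) ^ i * (numStrictChains P i : ℤ)

/-- The barycentric subdivision of a finite poset: the nonempty totally ordered subsets,
ordered by inclusion. -/
noncomputable def Sd (P : FinPartOrd) : FinPartOrd :=
  haveI : Finite (PartialOrder.NonemptyFiniteChains P) :=
    Finite.of_injective PartialOrder.NonemptyFiniteChains.finset (fun _ _ h => PartialOrder.NonemptyFiniteChains.ext h)
  letI : Fintype (PartialOrder.NonemptyFiniteChains P) := Fintype.ofFinite _
  FinPartOrd.of (PartialOrder.NonemptyFiniteChains P)

/-- The zeta series `Z_P(s) = ∑ #N_i(P) s^i`, as a power series over `ℂ`. -/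
noncomputable def zetaSeries (P : Type*) [PartialOrder P] : PowerSeries ℂ :=
  PowerSeries.mk fun i => (numChains P i : ℂ)

open Classical in
/-- The numbers of weakly increasing sequences of length `i` that start at `p` satisfy the
recursion given by the adjacency matrix of `P`. -/
theorem exists_chainsFrom (P : Type*) [PartialOrder P] [Fintype P] :
    ∃ c : P → ℕ → ℂ, (∀ i, (numChains P i : ℂ) = ∑ p, c p i) ∧ (∀ p, c p 0 = 1) ∧
      ∀ p i, c p (i + 1) = ∑ q, (if p ≤ q then 1 else 0) * c q i := by
  refine ⟨fun p i => ∑ x : Fin (i + 1) → P, if x 0 = p ∧ Monotone x then 1 else 0,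
    fun i => ?_, fun p => ?_, fun p i => ?_⟩ <;> beta_reduce
  · rw [Finset.sum_comm, numChains, Nat.card_eq_fintype_card, Fintype.card_subtype,
      Finset.card_filter, Nat.cast_sum]
    refine Finset.sum_congr rfl fun x _ => ?_
    by_cases hx : Monotone x <;> simp [hx]
  · rw [Fintype.sum_eq_single (fun _ => p)]
    · simp [monotone_const]
    · intro x hx
      rw [if_neg]
      rintro ⟨h, -⟩
      exact hx (funext fun j => by rw [← h]; congr 1; ext; omega)
  · rw [← Fintype.sum_equiv (Fin.consEquiv (n := i + 1) (fun _ => P)) (fun z =>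
      if z.1 = p ∧ (z.1 ≤ z.2 0 ∧ Monotone z.2) then (1 : ℂ) else 0) _ ?_,
      Fintype.sum_prod_type, Finset.sum_comm]
    · simp_rw [Finset.mul_sum]
      rw [Finset.sum_comm (s := (Finset.univ : Finset P))]
      refine Finset.sum_congr rfl fun x _ => ?_
      rw [Fintype.sum_eq_single p (by intro a ha; simp [ha]),
        Fintype.sum_eq_single (x 0) (by intro a ha; simp [ha.symm])]
      by_cases h : p ≤ x 0 <;> simp [h]
    · rintro ⟨a, x⟩
      have : Monotone (Fin.cons a x : Fin (i + 2) → P) ↔ a ≤ x 0 ∧ Monotone x :=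
        monotone_vecCons
      simp [Fin.consEquiv, this]

open scoped RatFunc Classical in
/-- The zeta series is the expansion at `0` of a unique rational function. -/
theorem existsUnique_zetaFunction (P : Type*) [PartialOrder P] [Finite P] :
    ∃! Z : RatFunc ℂ, (Z : LaurentSeries ℂ) = (zetaSeries P : LaurentSeries ℂ) := by
  have := Fintype.ofFinite P
  refine existsUnique_of_exists_of_unique ?_
    fun Z W hZ hW => (algebraMap (RatFunc ℂ) (LaurentSeries ℂ)).injective (hZ.trans hW.symm)
  obtain ⟨c, hc, hc0, hcs⟩ := exists_chainsFrom P
  let A : Matrix P P ℂ := fun p q => if p ≤ q then 1 else 0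
  let B : Matrix P P (Polynomial ℂ) := 1 - (Polynomial.X : Polynomial ℂ) • A.map Polynomial.C
  let φ : Polynomial ℂ →+* PowerSeries ℂ := Polynomial.coeToPowerSeries.ringHom
  let v : P → PowerSeries ℂ := fun p => PowerSeries.mk (c p)
  have hv : (B.map φ).mulVec v = 1 := by
    ext p i
    have h1 : B.map φ = 1 - (PowerSeries.X : PowerSeries ℂ) • A.map (PowerSeries.C) := by
      ext a b : 2
      by_cases hab : a = b <;> simp [B, φ, hab, (PowerSeries.commute_X _).eq]
    rw [h1, Matrix.sub_mulVec, Matrix.one_mulVec, Matrix.smul_mulVec]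
    cases i with
    | zero => simp [v, hc0]
    | succ i =>
      have h2 : ∀ q, PowerSeries.coeff i ((A.map PowerSeries.C) p q * PowerSeries.mk (c q)) =
          (if p ≤ q then 1 else 0) * c q i := fun q => by
        rw [Matrix.map_apply, PowerSeries.coeff_C_mul, PowerSeries.coeff_mk]
      simp only [v, Matrix.mulVec, dotProduct, Pi.sub_apply, Pi.smul_apply, smul_eq_mul,
        map_sub, PowerSeries.coeff_succ_X_mul, map_sum, h2, PowerSeries.coeff_mk, hcs, sub_self]
      simp [PowerSeries.coeff_one]
  have hz : zetaSeries P = ∑ p, v p := by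
    ext i; simp [zetaSeries, v, hc]
  have hdet : φ B.det * zetaSeries P = φ (∑ p, ∑ q, B.adjugate p q) := by
    have h2 : φ B.det • v = (B.adjugate.map φ).mulVec 1 := by
      have h3 : (B.map φ).adjugate = B.adjugate.map φ := (RingHom.map_adjugate φ B).symm
      rw [← hv, Matrix.mulVec_mulVec, ← h3, Matrix.adjugate_mul, Matrix.smul_mulVec,
        Matrix.one_mulVec, RingHom.map_det]
      rfl
    rw [hz, Finset.mul_sum, map_sum]
    refine Finset.sum_congr rfl fun p _ => ?_
    simpa [Matrix.mulVec, dotProduct] using congrFun h2 p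
  have hB : B.det ≠ 0 := by
    intro h
    have : B.det.eval 0 = 1 := Matrix.eval_charpolyRev (M := A)
    simp [h] at this
  refine ⟨algebraMap _ _ (∑ p, ∑ q, B.adjugate p q) / algebraMap _ _ B.det, ?_⟩
  have hB' : algebraMap (Polynomial ℂ) (LaurentSeries ℂ) B.det ≠ 0 := by
    rw [IsScalarTower.algebraMap_apply (Polynomial ℂ) (RatFunc ℂ) (LaurentSeries ℂ)]
    simpa using hB
  rw [RatFunc.algebraMap_apply_div, div_eq_iff hB', mul_comm]
  have hφ : ∀ p : Polynomial ℂ,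
      algebraMap (Polynomial ℂ) (LaurentSeries ℂ) p = ((φ p : PowerSeries ℂ) : LaurentSeries ℂ) := by
    intro p
    rw [IsScalarTower.algebraMap_apply (Polynomial ℂ) (RatFunc ℂ) (LaurentSeries ℂ)]
    exact (RatFunc.coe_coe p).symm
  rw [hφ, hφ, ← map_mul, hdet]

/-- The zeta series of a finite poset as a rational function of a complex variable: the unique
rational function whose power series expansion at `0` is `∑ #N_i(P) s^i`. -/
noncomputable def zetaFunction (P : Type*) [PartialOrder P] [Finite P] : RatFunc ℂ :=
  (existsUnique_zetaFunction P).choose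

/-- The defining property of `zetaFunction`. -/
theorem coe_zetaFunction (P : Type*) [PartialOrder P] [Finite P] :
    (zetaFunction P : LaurentSeries ℂ) = (zetaSeries P : LaurentSeries ℂ) :=
  (existsUnique_zetaFunction P).choose_spec.1

/-- The complex zeros of `Z_P(s)`, with multiplicity: since `RatFunc.num` and `RatFunc.denom` are
coprime, these are the roots of the numerator. -/
noncomputable def zetaZeros (P : Type*) [PartialOrder P] [Finite P] : Multiset ℂ :=
  (zetaFunction P).num.roots

/-! Let `f` be the polynomial whose coefficient at `X ^ (j + 1)` counts strict chains of length `j`.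
Inserting repetitions into strict chains gives `Z_P(s) = n(s) / (1 - s) ^ (d + 1)` with `n(s) = ∑
f_{j+1} s ^ j (1 - s) ^ (d - j)`. Here `n(1) = f_{d+1} ≠ 0`, so nothing cancels and the zeros are
the roots of `n`; its coefficient at `s ^ d` is `χ(P)` up to sign, so there are `d` of them
(`zetaZeros_eq_roots`, `coeff_zetaNumer_self`).

Barycentric subdivision acts on `f` by a fixed linear map `subdiv`, triangular on monomials with
diagonal entries `n!` (`coeff_succ_subdiv_fPoly`). With `D = d + 1`, the iterates divided by `D! ^
k` therefore converge to an eigenvector `v` for `D!` (`exists_limit_subdiv`). The map commutes with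
`X ↦ -1 - X` (`subdiv_comp`), so it preserves `f(-1) = -χ(P)`, which forces `v(-1) = 0`, and `v` is
symmetric up to sign (`comp_eq_of_subdiv_eq`).

Hence the rescaled numerators keep degree `d` but tend to a polynomial of degree `d - 1`, whose
leading and constant coefficients are both `v_1 > 0`. One root escapes to infinity; it is eventually
the only root of its modulus, so it is real. The others tend to the roots of the limit, whose
product is `(-1) ^ (d - 1)` (`roots_of_tendsto_degree_drop`). -/

/-! ### Roots of convergent sequences of polynomials. -/

section RootConvergence

open Polynomial

/-- If the coefficients of the monic polynomials with roots `β k i`, `i ∈ S`, converge, then so do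
the roots, after a reordering for each `k`. -/
theorem exists_perm_tendsto_roots {ι : Type*} [DecidableEq ι] (S : Finset ι) :
    ∀ β : ℕ → ι → ℂ,
      (∀ n, ∃ l, Tendsto (fun k => (∏ i ∈ S, (X - C (β k i))).coeff n) atTop (𝓝 l)) →
      ∃ σ : ℕ → Equiv.Perm ι, (∀ k, ∀ i ∉ S, σ k i = i) ∧
        ∀ i ∈ S, ∃ α, Tendsto (fun k => β k (σ k i)) atTop (𝓝 α) := by
  induction S using Finset.induction_on with
  | empty => exact fun β _ => ⟨fun _ => 1, by simp, by simp⟩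
  | insert a S ha ih =>
    intro β hβ
    set Q : ℕ → ℂ[X] := fun k => ∏ i ∈ insert a S, (X - C (β k i)) with hQ
    choose l hl using hβ
    have hdeg : ∀ k, (Q k).natDegree = S.card + 1 := fun k => by
      rw [hQ, natDegree_prod_of_monic _ _ fun i _ => monic_X_sub_C _]
      simp [ha]
    have hmonic : ∀ k, (Q k).Monic := fun k => monic_prod_of_monic _ _ fun i _ => monic_X_sub_C _
    have hev : ∀ z, Tendsto (fun k => (Q k).eval z) atTop
        (𝓝 (∑ n ∈ Finset.range (S.card + 2), l n * z ^ n)) := fun z => by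
      have : ∀ k, (Q k).eval z = ∑ n ∈ Finset.range (S.card + 2), (Q k).coeff n * z ^ n :=
        fun k => eval_eq_sum_range' (by rw [hdeg]; omega) z
      simp_rw [this]
      exact tendsto_finsetSum _ fun n _ => (hl n).mul_const _
    have hlead : l (S.card + 1) = 1 := by
      refine tendsto_nhds_unique (hl _) ?_
      have : ∀ k, (Q k).coeff (S.card + 1) = 1 := fun k => by
        rw [← hdeg k]; exact hmonic k
      simp_rw [hQ] at this
      simp_rw [this]
      exact tendsto_const_nhds
    -- The coefficientwise limit is monic of positive degree, so it has a root `α`. As `‖Q k (α)‖`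
    -- is the product of the distances from `α` to the roots of `Q k`, the nearest root tends to
    -- `α`.
    obtain ⟨α, hα⟩ : ∃ α, ∑ n ∈ Finset.range (S.card + 2), l n * α ^ n = 0 := by
      set A : ℂ[X] := ∑ n ∈ Finset.range (S.card + 2), C (l n) * X ^ n with hA
      have hc : A.coeff (S.card + 1) = 1 := by
        simp [hA, hlead]
      have hA0 : A.degree ≠ 0 := by
        intro h
        rw [eq_C_of_degree_eq_zero h] at hc
        simp at hc
      obtain ⟨α, hα⟩ := IsAlgClosed.exists_root A hA0
      refine ⟨α, ?_⟩
      simpa [hA, IsRoot.def, eval_finsetSum] using hα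
    have hmin : ∀ k, ∃ i ∈ insert a S, ∀ j ∈ insert a S, ‖α - β k i‖ ≤ ‖α - β k j‖ :=
      fun k => Finset.exists_min_image _ _ ⟨a, by simp⟩
    choose m hm hmin using hmin
    have hmα : Tendsto (fun k => β k (m k)) atTop (𝓝 α) := by
      have h0 : Tendsto (fun k => ‖(Q k).eval α‖) atTop (𝓝 0) := by
        simpa [hα] using (hev α).norm
      have h1 : ∀ k, ‖α - β k (m k)‖ ^ (S.card + 1) ≤ ‖(Q k).eval α‖ := fun k => by
        simp only [hQ, eval_prod, eval_sub, eval_X, eval_C, norm_prod]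
        rw [← Finset.card_insert_of_notMem ha, ← Finset.prod_const]
        exact Finset.prod_le_prod (fun _ _ => norm_nonneg _) fun j hj => hmin k j hj
      have h2 : Tendsto (fun k => ‖α - β k (m k)‖ ^ (S.card + 1)) atTop (𝓝 0) :=
        squeeze_zero (fun k => by positivity) h1 h0
      rw [tendsto_iff_norm_sub_tendsto_zero, Metric.tendsto_atTop]
      intro ε hε
      obtain ⟨N, hN⟩ := Metric.tendsto_atTop.1 h2 (ε ^ (S.card + 1)) (by positivity)
      refine ⟨N, fun k hk => ?_⟩
      have := hN k hk
      rw [Real.dist_0_eq_abs, abs_of_nonneg (by positivity)] at this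
      rw [Real.dist_0_eq_abs, abs_of_nonneg (by positivity), norm_sub_rev]
      exact lt_of_pow_lt_pow_left₀ _ hε.le this
    -- Relabel so that the nearest root has index `a`; the induction hypothesis then applies to the
    -- quotient by `X - γ k a`.
    set γ : ℕ → ι → ℂ := fun k i => β k (Equiv.swap a (m k) i) with hγ
    have hγa : Tendsto (fun k => γ k a) atTop (𝓝 α) := by simpa [hγ] using hmα
    have hQγ : ∀ k, Q k = (X - C (γ k a)) * ∏ i ∈ S, (X - C (γ k i)) := fun k => by
      rw [← Finset.prod_insert (f := fun i => X - C (γ k i)) ha]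
      refine (Finset.prod_equiv (Equiv.swap a (m k)) (fun i => ?_) fun i _ => rfl).symm
      have := hm k
      by_cases h1 : i = a
      · subst h1; simpa using this
      by_cases h2 : i = m k
      · subst h2; simp [this]
      rw [Equiv.swap_apply_of_ne_of_ne h1 h2]
    have hcoeff : ∀ n, ∃ l, Tendsto (fun k => (∏ i ∈ S, (X - C (γ k i))).coeff n) atTop (𝓝 l) := by
      have hbig : ∀ n, S.card < n → ∀ k, (∏ i ∈ S, (X - C (γ k i))).coeff n = 0 := fun n hn k => by
        apply coeff_eq_zero_of_natDegree_lt
        rw [natDegree_prod_of_monic _ _ fun i _ => monic_X_sub_C _]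
        simpa using hn
      -- Synthetic division from the top: if `Q = (X - γ) R`, then `R_n = Q_{n+1} + γ R_{n+1}`.
      have hrec : ∀ n, (∃ l, Tendsto (fun k => (∏ i ∈ S, (X - C (γ k i))).coeff (n + 1))
          atTop (𝓝 l)) →
          ∃ l, Tendsto (fun k => (∏ i ∈ S, (X - C (γ k i))).coeff n) atTop (𝓝 l) := by
        rintro n ⟨l', hl'⟩
        refine ⟨l (n + 1) + α * l', ((hl (n + 1)).add (hγa.mul hl')).congr fun k => ?_⟩
        have := congrArg (fun p => coeff p (n + 1)) (hQγ k)
        simp only [sub_mul, coeff_sub, coeff_X_mul, coeff_C_mul] at this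
        simp only [hQ] at this
        rw [this]; ring
      intro n
      by_cases hn : S.card < n
      · exact ⟨0, by simp_rw [hbig n hn]; exact tendsto_const_nhds⟩
      · refine Nat.decreasingInduction' (P := fun n => ∃ l, Tendsto
          (fun k => (∏ i ∈ S, (X - C (γ k i))).coeff n) atTop (𝓝 l))
          (fun k _ _ h => hrec k h) (show n ≤ S.card + 1 by omega)
          ⟨0, by simp_rw [hbig _ (Nat.lt_succ_self _)]; exact tendsto_const_nhds⟩
    obtain ⟨σ, hσ, hσt⟩ := ih γ hcoeff
    refine ⟨fun k => Equiv.swap a (m k) * σ k, fun k i hi => ?_, fun i hi => ?_⟩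
    · have hi' := hi
      rw [Finset.mem_insert, not_or] at hi
      rw [Equiv.Perm.mul_apply, hσ k i hi.2]
      exact Equiv.swap_apply_of_ne_of_ne hi.1 fun h => hi' (h ▸ hm k)
    · rcases Finset.mem_insert.1 hi with rfl | hi
      · refine ⟨α, hγa.congr fun k => ?_⟩
        simp [hγ, hσ k i ha]
      · exact hσt i hi

theorem Icc_one_eq_insert {d : ℕ} (hd : 1 ≤ d) :
    Finset.Icc 1 d = insert 1 (Finset.Icc 2 d) := by
  ext i; simp only [Finset.mem_Icc, Finset.mem_insert]; omega

/-- The behaviour of the roots of real polynomials of degree `d` that converge to a polynomial of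
degree `d - 1` with nonzero constant coefficient. -/
theorem roots_of_tendsto_degree_drop {d : ℕ} (hd : 1 ≤ d) (q : ℕ → ℝ[X]) (l : ℕ → ℝ)
    (hq : ∀ k, (q k).natDegree = d) (hl : ∀ n, Tendsto (fun k => (q k).coeff n) atTop (𝓝 (l n)))
    (hld : l d = 0) (hl0 : l 0 ≠ 0) (hl1 : l (d - 1) ≠ 0) (β : ℕ → ℕ → ℂ)
    (hβ : ∀ k, (Finset.Icc 1 d).val.map (β k) = ((q k).map (algebraMap ℝ ℂ)).roots)
    (hmax : ∀ k, ∀ i ∈ Finset.Icc 1 d, ‖β k i‖ ≤ ‖β k 1‖) :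
    Tendsto (fun k => ‖β k 1‖) atTop atTop ∧
      (∃ σ : ℕ → Equiv.Perm ℕ, (∀ k, ∀ i ∉ Finset.Icc 2 d, σ k i = i) ∧
        ∀ i ∈ Finset.Icc 2 d, ∃ α : ℂ, Tendsto (fun k => β k (σ k i)) atTop (𝓝 α)) ∧
      (∀ᶠ k in atTop, (β k 1).im = 0) ∧
      Tendsto (fun k => ∏ i ∈ Finset.Icc 2 d, β k i) atTop
        (𝓝 ((-1) ^ (d - 1) * (l 0 / l (d - 1) : ℝ))) := by
  have hinj : Function.Injective (algebraMap ℝ ℂ) := (algebraMap ℝ ℂ).injective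
  set Q : ℕ → ℂ[X] := fun k => (q k).map (algebraMap ℝ ℂ) with hQ
  have hQd : ∀ k, (Q k).natDegree = d := fun k => by
    rw [hQ, natDegree_map_eq_of_injective hinj, hq]
  have hQ0 : ∀ k, Q k ≠ 0 := fun k h => by
    have := hQd k; rw [h] at this; simp at this; omega
  have hQl : ∀ n, Tendsto (fun k => (Q k).coeff n) atTop (𝓝 (l n : ℂ)) := fun n => by
    simp only [hQ, coeff_map]
    exact (Complex.continuous_ofReal.tendsto _).comp (hl n)
  set c : ℕ → ℂ := fun k => (Q k).coeff d with hc
  have hc0 : ∀ k, c k ≠ 0 := fun k => by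
    have := leadingCoeff_ne_zero.2 (hQ0 k)
    rwa [leadingCoeff, hQd] at this
  have hfac : ∀ k, Q k = C (c k) * ∏ i ∈ Finset.Icc 1 d, (X - C (β k i)) := fun k => by
    have h := (IsAlgClosed.splits (Q k)).eq_prod_roots
    rw [leadingCoeff, hQd, ← hβ k, Multiset.map_map] at h
    exact h
  have hprod0 : ∀ k, (Q k).coeff 0 = c k * ∏ i ∈ Finset.Icc 1 d, (-β k i) := fun k => by
    conv_lhs => rw [hfac k, coeff_C_mul, coeff_zero_eq_eval_zero, eval_prod]
    simp
  -- the largest root tends to infinity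
  have h1 : Tendsto (fun k => ‖β k 1‖) atTop atTop := by
    have hratio : Tendsto (fun k => ‖(Q k).coeff 0‖ / ‖c k‖) atTop atTop := by
      have hcz : Tendsto (fun k => ‖c k‖) atTop (𝓝[>] 0) := by
        refine tendsto_nhdsWithin_iff.2 ⟨?_, .of_forall fun k => norm_pos_iff.2 (hc0 k)⟩
        simpa [hld] using (hQl d).norm
      simp_rw [div_eq_mul_inv]
      exact (hQl 0).norm.pos_mul_atTop (by simpa using hl0) hcz.inv_tendsto_nhdsGT_zero
    have hle : ∀ k, ‖(Q k).coeff 0‖ / ‖c k‖ ≤ ‖β k 1‖ ^ d := fun k => by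
      rw [hprod0 k, norm_mul, mul_div_cancel_left₀ _ (norm_ne_zero_iff.2 (hc0 k)), norm_prod]
      have h : ∏ _i ∈ Finset.Icc 1 d, ‖β k 1‖ = ‖β k 1‖ ^ d := by simp
      rw [← h]
      refine Finset.prod_le_prod (fun _ _ => norm_nonneg _) fun i hi => ?_
      rw [norm_neg]
      exact hmax k i hi
    have hpow := tendsto_atTop_mono hle hratio
    refine tendsto_atTop.2 fun B => ?_
    filter_upwards [tendsto_atTop.1 hpow (|B| ^ d)] with k hk
    exact (le_abs_self B).trans (le_of_pow_le_pow_left₀ (by omega) (norm_nonneg _) hk)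
  set R : ℕ → ℂ[X] := fun k => ∏ i ∈ Finset.Icc 2 d, (X - C (β k i)) with hR
  have hRm : ∀ k, (R k).Monic := fun k => monic_prod_of_monic _ _ fun i _ => monic_X_sub_C _
  have hRd : ∀ k, (R k).natDegree = d - 1 := fun k => by
    rw [hR, natDegree_prod_of_monic _ _ fun i _ => monic_X_sub_C _]
    simp
  have hRlead : ∀ k, (R k).coeff (d - 1) = 1 := fun k => by rw [← hRd k]; exact hRm k
  have hQR : ∀ k, Q k = C (c k) * ((X - C (β k 1)) * R k) := fun k => by
    rw [hfac k, Icc_one_eq_insert hd, Finset.prod_insert (by simp)]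
  -- Writing `Q = e (1 - X / β₁) R`, the factor `1 - X / β₁` tends to `1`, so `e R` has the same
  -- coefficientwise limit as `Q`, and `e` tends to `l (d - 1)` because `R` is monic.
  set e : ℕ → ℂ := fun k => -(c k * β k 1) with he
  have hβinv : Tendsto (fun k => (β k 1)⁻¹) atTop (𝓝 0) :=
    tendsto_inv₀_cobounded.comp (tendsto_norm_atTop_iff_cobounded.1 h1)
  have heR : ∀ n, Tendsto (fun k => e k * (R k).coeff n) atTop (𝓝 (l n : ℂ)) := by
    intro n
    induction n with
    | zero =>
      refine (hQl 0).congr fun k => ?_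
      rw [hQR k]; simp [he, mul_assoc, sub_mul]
    | succ n ih =>
      have := (hQl (n + 1)).add (ih.mul hβinv)
      rw [mul_zero, add_zero] at this
      refine this.congr' ?_
      filter_upwards [h1.eventually_gt_atTop 0] with k hk
      have hk' : β k 1 ≠ 0 := norm_pos_iff.1 hk
      rw [hQR k]
      simp only [he, sub_mul, coeff_C_mul, coeff_sub, coeff_X_mul]
      field_simp
      ring
  have he' : Tendsto e atTop (𝓝 (l (d - 1) : ℂ)) := by simpa [hRlead] using heR (d - 1)
  have hl1' : (l (d - 1) : ℂ) ≠ 0 := by exact_mod_cast hl1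
  have hRl : ∀ n, Tendsto (fun k => (R k).coeff n) atTop (𝓝 (l n / l (d - 1) : ℂ)) := fun n => by
    refine ((heR n).div he' hl1').congr' ?_
    filter_upwards [he'.eventually_ne hl1'] with k hk
    simp only [Pi.div_apply]
    field_simp
  obtain ⟨σ, hσ, hσt⟩ := exists_perm_tendsto_roots (Finset.Icc 2 d) β fun n => ⟨_, hRl n⟩
  refine ⟨h1, ⟨σ, hσ, hσt⟩, ?_, ?_⟩
  -- The other roots stay bounded, so eventually `β k 1` is the only root of its modulus. Its
  -- conjugate is a root of the same modulus, hence equal to it.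
  · have hsmall : ∀ᶠ k in atTop, ∀ i ∈ Finset.Icc 2 d, ‖β k (σ k i)‖ < ‖β k 1‖ := by
      rw [Filter.eventually_all_finset]
      intro i hi
      obtain ⟨α, hα⟩ := hσt i hi
      filter_upwards [hα.norm.eventually_lt_const (lt_add_one ‖α‖),
        h1.eventually_gt_atTop (‖α‖ + 1)] with k h2 h3 using h2.trans h3
    filter_upwards [hsmall] with k hk
    have hroot : ∀ z, z ∈ (Q k).roots ↔ ∃ i ∈ Finset.Icc 1 d, β k i = z := fun z => by
      rw [← hβ k]; simp
    have h1mem : β k 1 ∈ (Q k).roots := (hroot _).2 ⟨1, by simp [hd], rfl⟩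
    have hconj : (starRingEnd ℂ) (β k 1) ∈ (Q k).roots := by
      rw [mem_roots (hQ0 k), IsRoot.def] at h1mem ⊢
      rw [hQ, eval_map_algebraMap] at h1mem ⊢
      have := aeval_conj (q k) (β k 1)
      rw [h1mem, map_zero] at this
      exact this
    obtain ⟨j, hj, hjc⟩ := (hroot _).1 hconj
    have hj1 : j = 1 := by
      by_contra hne
      have hj2 : j ∈ Finset.Icc 2 d := by
        simp only [Finset.mem_Icc] at hj ⊢; omega
      have hi : (σ k).symm j ∈ Finset.Icc 2 d := by
        by_contra hi
        have := hσ k _ hi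
        rw [Equiv.apply_symm_apply] at this
        exact hi (this ▸ hj2)
      have := hk _ hi
      rw [Equiv.apply_symm_apply, hjc, RCLike.norm_conj] at this
      exact lt_irrefl _ this
    subst hj1
    exact Complex.conj_eq_iff_im.1 hjc.symm
  · have := (hRl 0).const_mul ((-1) ^ (d - 1))
    rw [Complex.ofReal_div]
    refine this.congr fun k => ?_
    rw [hR, coeff_zero_eq_eval_zero, eval_prod]
    simp only [eval_sub, eval_X, eval_C, zero_sub, Finset.prod_neg]
    rw [← mul_assoc]
    simp [← mul_pow]

end RootConvergence

/-! ### The subdivision operator on polynomials and its top eigenvector. -/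

section Subdivision

open Polynomial

/-- The differential operator `h ↦ X ((1 + X) h)'` on polynomials. -/
noncomputable def theta : Module.End ℝ ℝ[X] :=
  LinearMap.mulLeft ℝ X ∘ₗ derivative ∘ₗ LinearMap.mulLeft ℝ (1 + X)

/-- The linear operator on `f`-polynomials that describes the barycentric subdivision: it maps
`X ^ n` to `theta ^ n 1`. -/
noncomputable def subdiv : ℝ[X] →ₗ[ℝ] ℝ[X] :=
  LinearMap.applyₗ 1 ∘ₗ (aeval theta).toLinearMap

theorem theta_apply (h : ℝ[X]) : theta h = X * derivative ((1 + X) * h) := rfl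

theorem subdiv_apply (g : ℝ[X]) : subdiv g = aeval theta g 1 := rfl

/-- The geometric polynomials. -/
noncomputable def geomPoly (n : ℕ) : ℝ[X] := (theta ^ n) 1

theorem geomPoly_zero : geomPoly 0 = 1 := rfl

theorem geomPoly_succ (n : ℕ) : geomPoly (n + 1) = theta (geomPoly n) := by
  rw [geomPoly, pow_succ', Module.End.mul_apply, geomPoly]

theorem coeff_theta_zero (h : ℝ[X]) : (theta h).coeff 0 = 0 := by simp [theta_apply]

theorem coeff_theta_succ (h : ℝ[X]) (m : ℕ) :
    (theta h).coeff (m + 1) = (m + 1) * (h.coeff (m + 1) + h.coeff m) := by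
  rw [theta_apply, coeff_X_mul, coeff_derivative, add_mul, one_mul, coeff_add, coeff_X_mul,
    mul_comm]

/-- With `coeff_geomPoly_self`, this makes `subdiv` triangular on monomials with diagonal entries
`n!`. -/
theorem coeff_geomPoly_of_lt {n m : ℕ} (h : n < m) : (geomPoly n).coeff m = 0 := by
  induction n generalizing m with
  | zero => rw [geomPoly_zero, coeff_one, if_neg (by omega)]
  | succ n ih =>
    obtain ⟨m, rfl⟩ := Nat.exists_eq_succ_of_ne_zero (show m ≠ 0 by omega)
    rw [geomPoly_succ, Nat.succ_eq_add_one, coeff_theta_succ, ih (by omega), ih (by omega)]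
    simp

theorem coeff_geomPoly_self (n : ℕ) : (geomPoly n).coeff n = n.factorial := by
  induction n with
  | zero => simp [geomPoly_zero]
  | succ n ih =>
    rw [geomPoly_succ, coeff_theta_succ, ih, coeff_geomPoly_of_lt (Nat.lt_succ_self n),
      Nat.factorial_succ]
    push_cast; ring

theorem coeff_geomPoly_nonneg (n m : ℕ) : 0 ≤ (geomPoly n).coeff m := by
  induction n generalizing m with
  | zero => rw [geomPoly_zero, coeff_one]; split_ifs <;> norm_num
  | succ n ih =>
    rw [geomPoly_succ]
    cases m with
    | zero => rw [coeff_theta_zero]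
    | succ m =>
      rw [coeff_theta_succ]
      have := ih m
      have := ih (m + 1)
      positivity

theorem coeff_geomPoly_succ_zero (n : ℕ) : (geomPoly (n + 1)).coeff 0 = 0 := by
  rw [geomPoly_succ, coeff_theta_zero]

theorem coeff_geomPoly_succ_one (n : ℕ) : (geomPoly (n + 1)).coeff 1 = 1 := by
  induction n with
  | zero => rw [coeff_geomPoly_self]; simp
  | succ n ih => rw [geomPoly_succ, coeff_theta_succ, ih, coeff_geomPoly_succ_zero]; simp

theorem subdiv_eq_sum {N : ℕ} {g : ℝ[X]} (hg : g.natDegree < N) :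
    subdiv g = ∑ n ∈ Finset.range N, C (g.coeff n) * geomPoly n := by
  rw [subdiv_apply, aeval_eq_sum_range' hg, LinearMap.sum_apply]
  simp [geomPoly, smul_eq_C_mul]

theorem coeff_subdiv {N : ℕ} {g : ℝ[X]} (hg : g.natDegree < N) (m : ℕ) :
    (subdiv g).coeff m = ∑ n ∈ Finset.range N, g.coeff n * (geomPoly n).coeff m := by
  simp [subdiv_eq_sum hg]

theorem coeff_subdiv_zero (g : ℝ[X]) : (subdiv g).coeff 0 = g.coeff 0 := by
  rw [coeff_subdiv (Nat.lt_succ_self _), Finset.sum_eq_single 0]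
  · simp [geomPoly_zero]
  · intro n _ hn
    obtain ⟨n, rfl⟩ := Nat.exists_eq_succ_of_ne_zero hn
    rw [Nat.succ_eq_add_one, coeff_geomPoly_succ_zero, mul_zero]
  · simp

theorem coeff_subdiv_natDegree {D : ℕ} {g : ℝ[X]} (hg : g.natDegree ≤ D) :
    (subdiv g).coeff D = D.factorial * g.coeff D := by
  rw [coeff_subdiv (Nat.lt_succ_of_le hg), Finset.sum_range_succ, Finset.sum_eq_zero,
    coeff_geomPoly_self, zero_add, mul_comm]
  intro n hn
  rw [coeff_geomPoly_of_lt (Finset.mem_range.1 hn), mul_zero]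

theorem natDegree_subdiv_le {D : ℕ} {g : ℝ[X]} (hg : g.natDegree ≤ D) :
    (subdiv g).natDegree ≤ D := by
  rw [natDegree_le_iff_coeff_eq_zero]
  intro m hm
  rw [coeff_subdiv (Nat.lt_succ_of_le hg)]
  refine Finset.sum_eq_zero fun n hn => ?_
  rw [coeff_geomPoly_of_lt (by rw [Finset.mem_range] at hn; omega), mul_zero]

theorem natDegree_subdiv (g : ℝ[X]) : (subdiv g).natDegree = g.natDegree := by
  refine le_antisymm (natDegree_subdiv_le le_rfl) ?_
  by_cases hg : g = 0
  · simp [hg]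
  · apply le_natDegree_of_ne_zero
    rw [coeff_subdiv_natDegree le_rfl]
    exact mul_ne_zero (by exact_mod_cast Nat.factorial_ne_zero _) (leadingCoeff_ne_zero.2 hg)

/-- The substitution exchanges `X` and `1 + X` up to sign and reverses the derivative, so `theta`
turns into `h ↦ -(1 + X) (X h)'`, which is `-1 - theta`. -/
theorem theta_comp (h : ℝ[X]) :
    (theta h).comp (-1 - X) = (-1 - theta) (h.comp (-1 - X)) := by
  rw [LinearMap.sub_apply, LinearMap.neg_apply, Module.End.one_apply, theta_apply, theta_apply,
    derivative_mul, derivative_mul, derivative_comp]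
  simp only [mul_comp, add_comp, derivative_add, derivative_one, derivative_X, X_comp, one_comp,
    derivative_sub, derivative_neg, zero_add]
  ring

/-- Subdivision commutes with the substitution `X ↦ -1 - X`. -/
theorem subdiv_comp (g : ℝ[X]) : (subdiv g).comp (-1 - X) = subdiv (g.comp (-1 - X)) := by
  have key : ∀ n : ℕ, ∀ h : ℝ[X],
      ((theta ^ n) h).comp (-1 - X) = ((-1 - theta) ^ n) (h.comp (-1 - X)) := by
    intro n
    induction n with
    | zero => intro h; simp
    | succ n ih => intro h; rw [pow_succ, pow_succ, Module.End.mul_apply, Module.End.mul_apply, ih,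
        theta_comp]
  have h1 : aeval theta (-1 - X : ℝ[X]) = -1 - theta := by simp
  rw [subdiv_apply, subdiv_apply, aeval_comp, h1, aeval_eq_sum_range, aeval_eq_sum_range,
    LinearMap.sum_apply, LinearMap.sum_apply, ← coe_compRingHom_apply, map_sum]
  refine Finset.sum_congr rfl fun n _ => ?_
  rw [LinearMap.smul_apply, LinearMap.smul_apply, coe_compRingHom_apply, smul_comp, key, one_comp]

/-- The reflection `X ↦ -1 - X` moves `-1` to `0`, and the constant coefficient is preserved. On
`f`-polynomials this is the invariance of the Euler characteristic under subdivision. -/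
theorem eval_neg_one_subdiv (g : ℝ[X]) : (subdiv g).eval (-1) = g.eval (-1) := by
  have h : ∀ p : ℝ[X], p.eval (-1) = (p.comp (-1 - X)).coeff 0 := fun p => by
    rw [coeff_zero_eq_eval_zero, eval_comp]; simp
  rw [h, h, subdiv_comp, coeff_subdiv_zero]

/-- The recursion for geometric polynomials that counts chains of subsets by their next to last
member. -/
theorem geomPoly_eq_sum {n : ℕ} (hn : n ≠ 0) :
    geomPoly n = X * ∑ m ∈ Finset.range n, C (n.choose m : ℝ) * geomPoly m := by
  have hbin : ((1 + theta) ^ n) (1 : ℝ[X]) =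
      ∑ m ∈ Finset.range (n + 1), C (n.choose m : ℝ) * geomPoly m := by
    rw [add_comm, (Commute.one_right theta).add_pow, LinearMap.sum_apply]
    refine Finset.sum_congr rfl fun m _ => ?_
    rw [one_pow, mul_one, ← Nat.cast_comm, ← nsmul_eq_mul, LinearMap.smul_apply]
    simp [geomPoly]
  -- Multiplication by `X` carries `1 + theta`, and multiplication by `1 + X` carries `theta`, to
  -- the same derivation `D = X (1 + X) d/dX`. Since `D ^ n` kills `1` for `n ≠ 0`, it agrees on `X`
  -- and `1 + X`.
  have hshift : X * ((1 + theta) ^ n) (1 : ℝ[X]) = (1 + X) * geomPoly n := by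
    let D : Module.End ℝ ℝ[X] := LinearMap.mulLeft ℝ (X * (1 + X)) ∘ₗ derivative
    have hD : ∀ h, D h = X * (1 + X) * derivative h := fun _ => rfl
    have hX : ∀ n : ℕ, ∀ h : ℝ[X], X * ((1 + theta) ^ n) h = (D ^ n) (X * h) := by
      intro n
      induction n with
      | zero => simp
      | succ n ih =>
        intro h
        rw [pow_succ, pow_succ, Module.End.mul_apply, Module.End.mul_apply, ih]
        congr 1
        rw [LinearMap.add_apply, Module.End.one_apply, theta_apply, hD]
        simp only [derivative_mul, derivative_add, derivative_one, derivative_X]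
        ring
    have h1X : ∀ n : ℕ, ∀ h : ℝ[X], (1 + X) * (theta ^ n) h = (D ^ n) ((1 + X) * h) := by
      intro n
      induction n with
      | zero => simp
      | succ n ih =>
        intro h
        rw [pow_succ, pow_succ, Module.End.mul_apply, Module.End.mul_apply, ih]
        congr 1
        rw [theta_apply, hD]
        ring
    have hD1 : (D ^ n) 1 = 0 := by
      obtain ⟨n, rfl⟩ := Nat.exists_eq_succ_of_ne_zero hn
      rw [pow_succ, Module.End.mul_apply, hD]
      simp
    rw [hX, geomPoly, h1X, mul_one, mul_one, map_add, hD1, zero_add]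
  rw [hbin, Finset.sum_range_succ, Nat.choose_self] at hshift
  simp only [Nat.cast_one, C_1, one_mul, mul_add, add_mul] at hshift
  exact (add_right_cancel hshift).symm

/-- A polynomial eigenvector of `subdiv` whose eigenvalue is a factorial is symmetric. -/
theorem comp_eq_of_subdiv_eq {D : ℕ} (hD : 2 ≤ D) {v : ℝ[X]} (hv : v.natDegree ≤ D)
    (hLv : subdiv v = C (D.factorial : ℝ) * v) : v.comp (-1 - X) = (-1) ^ D * v := by
  -- The defect of symmetry `u` satisfies the same eigenvalue equation, but its coefficient at `X ^
  -- D` cancels. A nonzero `u` of degree `e < D` would have its leading coefficient multiplied by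
  -- `e!`, which differs from `D!`.
  set u := v.comp (-1 - X) - C ((-1) ^ D) * v with hu
  have hr : (-1 - X : ℝ[X]).natDegree = 1 := by
    rw [show (-1 - X : ℝ[X]) = C (-1) * X + C (-1) by simp; ring]
    exact natDegree_linear (by norm_num)
  have hcomp : (v.comp (-1 - X)).natDegree ≤ D := by
    rw [natDegree_comp, hr, mul_one]; exact hv
  have hLu : subdiv u = C (D.factorial : ℝ) * u := by
    rw [hu, map_sub, ← smul_eq_C_mul ((-1) ^ D), map_smul, ← subdiv_comp, hLv, mul_comp, C_comp]
    simp only [smul_eq_C_mul]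
    ring
  have hud : u.natDegree ≤ D := by
    refine (natDegree_sub_le _ _).trans (max_le hcomp ((natDegree_C_mul_le _ _).trans hv))
  have hcoef : u.coeff D = 0 := by
    have h1 : (v.comp (-1 - X)).coeff D = (-1) ^ D * v.coeff D := by
      rcases hv.lt_or_eq with hlt | heq
      · rw [coeff_eq_zero_of_natDegree_lt hlt, coeff_eq_zero_of_natDegree_lt, mul_zero]
        rw [natDegree_comp, hr, mul_one]; exact hlt
      · have h2 := coeff_comp_degree_mul_degree (p := v) (q := -1 - X) (by rw [hr]; exact one_ne_zero)
        rw [hr, mul_one] at h2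
        rw [← heq, h2, leadingCoeff, leadingCoeff, hr]
        simp [coeff_one, mul_comm]
    rw [hu, coeff_sub, coeff_C_mul, h1, sub_self]
  have hu0 : u = 0 := by
    by_contra hne
    have hlt : u.natDegree < D := by
      refine lt_of_le_of_ne hud fun h => hne ?_
      rw [← h] at hcoef
      exact leadingCoeff_eq_zero.1 hcoef
    have h1 := coeff_subdiv_natDegree (le_refl u.natDegree)
    rw [hLu, coeff_C_mul] at h1
    have h2 := mul_right_cancel₀ (leadingCoeff_ne_zero.2 hne) h1
    have h3 : D.factorial = u.natDegree.factorial := by exact_mod_cast h2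
    rcases Nat.eq_zero_or_pos u.natDegree with h0 | hpos
    · rw [h0, Nat.factorial_zero] at h3
      exact absurd h3 (Nat.one_lt_factorial.2 (by omega)).ne'
    · exact absurd h3 ((Nat.factorial_lt hpos).2 hlt).ne'
  rw [← sub_eq_zero, ← hu0, hu]
  simp

/-- Subtracting the fixed point of the limiting recursion leaves a contraction by `r` perturbed by a
null sequence. -/
theorem tendsto_of_affine_recursion {r : ℝ} (hr0 : 0 ≤ r) (hr : r < 1) {x c : ℕ → ℝ} {c₀ : ℝ}
    (hc : Tendsto c atTop (𝓝 c₀)) (hx : ∀ k, x (k + 1) = r * x k + c k) :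
    Tendsto x atTop (𝓝 (c₀ / (1 - r))) := by
  set L := c₀ / (1 - r) with hL
  have hfix : L = r * L + c₀ := by
    have : 1 - r ≠ 0 := by linarith
    rw [hL]; field_simp; ring
  have hy : ∀ k, x (k + 1) - L = r * (x k - L) + (c k - c₀) := fun k => by
    rw [hx]; linarith
  rw [Metric.tendsto_atTop]
  intro ε hε
  have hδ : 0 < ε / 2 * (1 - r) := mul_pos (half_pos hε) (by linarith)
  obtain ⟨N, hN⟩ := Metric.tendsto_atTop.1 hc _ hδ
  have hb : ∀ j, |x (N + j) - L| ≤ r ^ j * |x N - L| + ε / 2 := by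
    intro j
    induction j with
    | zero => simp; linarith
    | succ j ih =>
      rw [← add_assoc, hy]
      have h1 := hN (N + j) (by omega)
      rw [Real.dist_eq] at h1
      calc |r * (x (N + j) - L) + (c (N + j) - c₀)|
          ≤ r * |x (N + j) - L| + |c (N + j) - c₀| := by
            refine (abs_add_le _ _).trans_eq ?_
            rw [abs_mul, abs_of_nonneg hr0]
        _ ≤ r * (r ^ j * |x N - L| + ε / 2) + ε / 2 * (1 - r) := by gcongr
        _ = r ^ (j + 1) * |x N - L| + ε / 2 := by ring
  have hpow : Tendsto (fun j => r ^ j * |x N - L|) atTop (𝓝 0) := by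
    simpa using (tendsto_pow_atTop_nhds_zero_of_lt_one hr0 hr).mul_const |x N - L|
  obtain ⟨M, hM⟩ := Metric.tendsto_atTop.1 hpow (ε / 2) (by positivity)
  refine ⟨N + M, fun k hk => ?_⟩
  obtain ⟨j, rfl⟩ := Nat.exists_eq_add_of_le (show N ≤ k by omega)
  have h2 := hM j (by omega)
  rw [Real.dist_0_eq_abs, abs_of_nonneg (by positivity)] at h2
  rw [Real.dist_eq]
  linarith [hb j]

/-- Under iterated subdivision the normalized `f`-polynomials converge to an eigenvector. -/
theorem exists_limit_subdiv {D : ℕ} (hD : 2 ≤ D) (g : ℕ → ℝ[X]) (hg : ∀ k, (g k).natDegree ≤ D)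
    (hstep : ∀ k, g (k + 1) = subdiv (g k)) :
    ∃ v : ℝ[X], v.natDegree ≤ D ∧ v.coeff D = (g 0).coeff D ∧
      subdiv v = C (D.factorial : ℝ) * v ∧
      ∀ m, Tendsto (fun k => (g k).coeff m / (D.factorial : ℝ) ^ k) atTop (𝓝 (v.coeff m)) := by
  set lam : ℝ := (D.factorial : ℝ) with hlam
  have hlam0 : 0 < lam := by rw [hlam]; exact_mod_cast Nat.factorial_pos D
  set b : ℕ → ℕ → ℝ := fun k m => (g k).coeff m / lam ^ k with hb
  have hrec : ∀ k m, lam * b (k + 1) m =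
      ∑ n ∈ Finset.range (D + 1), b k n * (geomPoly n).coeff m := fun k m => by
    simp only [hb, hstep, coeff_subdiv (Nat.lt_succ_of_le (hg k)), div_mul_eq_mul_div,
      ← Finset.sum_div]
    field_simp
    ring
  have hconst : ∀ k, b k D = (g 0).coeff D := by
    intro k
    induction k with
    | zero => simp [hb]
    | succ k ih =>
      rw [← ih]
      simp only [hb, hstep, coeff_subdiv_natDegree (hg k), ← hlam]
      field_simp
      ring
  have hbig : ∀ m, D < m → ∀ k, b k m = 0 := fun m hm k => by
    simp [hb, coeff_eq_zero_of_natDegree_lt ((hg k).trans_lt hm)]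
  -- Induction downwards from `m = D`: by triangularity the `m`-th normalized coefficient obeys an
  -- affine recursion with ratio `m! / D! < 1`, driven by higher coefficients already known to
  -- converge. Truncated subtraction puts every `m ≥ D` at `j = 0`.
  have hconv : ∀ j m, D - m = j → ∃ l, Tendsto (fun k => b k m) atTop (𝓝 l) := by
    intro j
    induction j using Nat.strong_induction_on with
    | _ j ih =>
      intro m hm
      rcases lt_trichotomy m D with hlt | rfl | hgt
      · have ih' : ∀ n, ∃ l, m < n → n ≤ D → Tendsto (fun k => b k n) atTop (𝓝 l) := fun n => by
          by_cases h : m < n ∧ n ≤ D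
          · obtain ⟨l, hl⟩ := ih (D - n) (by omega) n rfl
            exact ⟨l, fun _ _ => hl⟩
          · exact ⟨0, fun h1 h2 => (h ⟨h1, h2⟩).elim⟩
        choose l hl using ih'
        have hlt' : (m.factorial : ℝ) < lam := by
          rw [hlam]
          rcases Nat.eq_zero_or_pos m with rfl | hpos
          · exact_mod_cast Nat.one_lt_factorial.2 (by omega)
          · exact_mod_cast (Nat.factorial_lt hpos).2 hlt
        refine ⟨_, tendsto_of_affine_recursion (r := m.factorial / lam) (by positivity)
          ((div_lt_one hlam0).2 hlt')
          (c := fun k => (∑ n ∈ Finset.Ioc m D, b k n * (geomPoly n).coeff m) / lam)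
          ((tendsto_finsetSum _ fun n hn => ((hl n (Finset.mem_Ioc.1 hn).1
            (Finset.mem_Ioc.1 hn).2).mul_const _)).div_const _) fun k => ?_⟩
        have h1 := hrec k m
        rw [← Finset.sum_subset (s₁ := Finset.Icc m D), ← Finset.Ioc_insert_left hlt.le,
          Finset.sum_insert (by simp), coeff_geomPoly_self] at h1
        · rw [eq_comm, ← mul_right_inj' hlam0.ne', h1]
          field_simp
        · intro n hn
          simp only [Finset.mem_Icc, Finset.mem_range] at hn ⊢
          omega
        · intro n hn hn'
          simp only [Finset.mem_Icc, Finset.mem_range] at hn hn'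
          rw [coeff_geomPoly_of_lt (by omega), mul_zero]
      · exact ⟨_, by simp_rw [hconst]; exact tendsto_const_nhds⟩
      · exact ⟨0, by simp_rw [hbig m hgt]; exact tendsto_const_nhds⟩
  have hconv' : ∀ m, ∃ l, Tendsto (fun k => b k m) atTop (𝓝 l) := fun m => hconv _ m rfl
  choose l hl using hconv'
  have hlbig : ∀ m, D < m → l m = 0 := fun m hm =>
    tendsto_nhds_unique (hl m) (by simp_rw [hbig m hm]; exact tendsto_const_nhds)
  set v : ℝ[X] := ∑ n ∈ Finset.range (D + 1), C (l n) * X ^ n with hv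
  have hvc : ∀ m, v.coeff m = l m := fun m => by
    simp only [hv, finsetSum_coeff, coeff_C_mul, coeff_X_pow, mul_ite, mul_one, mul_zero,
      Finset.sum_ite_eq, Finset.mem_range]
    split_ifs with h
    · rfl
    · rw [hlbig m (by omega)]
  have hvd : v.natDegree ≤ D := natDegree_le_iff_coeff_eq_zero.2 fun m hm => by
    rw [hvc, hlbig m hm]
  refine ⟨v, hvd, ?_, ?_, fun m => by rw [hvc]; exact hl m⟩
  · rw [hvc]
    exact tendsto_nhds_unique (hl D) (by simp_rw [hconst]; exact tendsto_const_nhds)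
  · ext m
    rw [coeff_subdiv (Nat.lt_succ_of_le hvd), coeff_C_mul]
    simp_rw [hvc]
    refine tendsto_nhds_unique (tendsto_finsetSum _ fun n _ => (hl n).mul_const _)
      ((((tendsto_add_atTop_iff_nat 1).2 (hl m)).const_mul lam).congr fun k => hrec k m)

end Subdivision

/-! ### Strict chains, `f`-polynomials and barycentric subdivision. -/

section Chains

open Polynomial

theorem numStrictChains_eq_zero {P : Type*} [PartialOrder P] [Finite P] [Nonempty P] {i : ℕ}
    (hi : posetDim P < i) : numStrictChains P i = 0 := by
  by_contra h
  exact absurd ((isGreatest_posetDim P).2 h) (not_le.2 hi)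

theorem nonempty_of_posetDim_ne_zero {P : Type*} [PartialOrder P] (h : posetDim P ≠ 0) :
    Nonempty P := by
  by_contra hP
  rw [not_nonempty_iff] at hP
  apply h
  have : {i : ℕ | numStrictChains P i ≠ 0} = ∅ := by
    ext i
    have : IsEmpty {x : Fin (i + 1) → P // StrictMono x} := ⟨fun x => hP.elim (x.1 0)⟩
    simp [numStrictChains]
  rw [posetDim, this]
  simp

/-- The `f`-polynomial of a poset: the coefficient of `X ^ (i + 1)` is the number of strict chains
of length `i`. -/
noncomputable def fPoly (P : Type*) [PartialOrder P] : ℝ[X] :=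
  ∑ j ∈ Finset.range (posetDim P + 1), C (numStrictChains P j : ℝ) * X ^ (j + 1)

theorem coeff_fPoly_zero (P : Type*) [PartialOrder P] : (fPoly P).coeff 0 = 0 := by
  simp [fPoly, finsetSum_coeff, coeff_X_pow]

theorem coeff_fPoly_succ (P : Type*) [PartialOrder P] [Finite P] [Nonempty P] (j : ℕ) :
    (fPoly P).coeff (j + 1) = numStrictChains P j := by
  simp only [fPoly, finsetSum_coeff, coeff_C_mul, coeff_X_pow, add_left_inj, mul_ite, mul_one,
    mul_zero, Finset.sum_ite_eq, Finset.mem_range]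
  split_ifs with h
  · rfl
  · rw [numStrictChains_eq_zero (by omega), Nat.cast_zero]

theorem natDegree_fPoly (P : Type*) [PartialOrder P] [Finite P] [Nonempty P] :
    (fPoly P).natDegree = posetDim P + 1 := by
  refine le_antisymm (natDegree_le_iff_coeff_eq_zero.2 fun m hm => ?_) ?_
  · obtain ⟨m, rfl⟩ := Nat.exists_eq_succ_of_ne_zero (show m ≠ 0 by omega)
    rw [Nat.succ_eq_add_one, coeff_fPoly_succ, numStrictChains_eq_zero (by omega), Nat.cast_zero]
  · apply le_natDegree_of_ne_zero
    rw [coeff_fPoly_succ]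
    exact_mod_cast (isGreatest_posetDim P).1

theorem eval_neg_one_fPoly (P : Type*) [PartialOrder P] :
    (fPoly P).eval (-1) = -(eulerChar P : ℝ) := by
  rw [fPoly, eulerChar, eval_finsetSum]
  push_cast
  rw [← Finset.sum_neg_distrib]
  refine Finset.sum_congr rfl fun j _ => ?_
  simp only [eval_mul, eval_C, eval_pow, eval_X]
  ring

open Classical in
/-- The numbers of strictly increasing sequences of length `i` with last term `p`. -/
theorem exists_strictChainsTo (P : Type*) [PartialOrder P] [Fintype P] :
    ∃ c : P → ℕ → ℝ, (∀ i, (numStrictChains P i : ℝ) = ∑ p, c p i) ∧ (∀ p, c p 0 = 1) ∧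
      ∀ p i, c p (i + 1) = ∑ q, (if q < p then 1 else 0) * c q i := by
  have hsnoc : ∀ (i : ℕ) (a : P) (x : Fin (i + 1) → P),
      StrictMono (Fin.snoc x a : Fin (i + 2) → P) ↔ x (Fin.last i) < a ∧ StrictMono x := by
    intro i a x
    rw [Fin.strictMono_iff_lt_succ, Fin.strictMono_iff_lt_succ, Fin.forall_fin_succ', and_comm]
    simp only [← Fin.castSucc_succ, Fin.snoc_castSucc, Fin.succ_last, Fin.snoc_last]
  refine ⟨fun p i => ∑ x : Fin (i + 1) → P, if x (Fin.last i) = p ∧ StrictMono x then 1 else 0,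
    fun i => ?_, fun p => ?_, fun p i => ?_⟩ <;> beta_reduce
  · rw [Finset.sum_comm, numStrictChains, Nat.card_eq_fintype_card, Fintype.card_subtype,
      Finset.card_filter, Nat.cast_sum]
    refine Finset.sum_congr rfl fun x _ => ?_
    by_cases hx : StrictMono x <;> simp [hx]
  · rw [Fintype.sum_eq_single (fun _ => p)]
    · simp [Subsingleton.strictMono]
    · intro x hx
      rw [if_neg]
      rintro ⟨h, -⟩
      exact hx (funext fun j => by rw [← h]; congr 1; ext; omega)
  · rw [← Fintype.sum_equiv (Fin.snocEquiv (n := i + 1) (fun _ => P)) (fun z =>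
      if z.1 = p ∧ (z.2 (Fin.last i) < z.1 ∧ StrictMono z.2) then (1 : ℝ) else 0) _ ?_,
      Fintype.sum_prod_type, Finset.sum_comm]
    · simp_rw [Finset.mul_sum]
      rw [Finset.sum_comm (s := (Finset.univ : Finset P))]
      refine Finset.sum_congr rfl fun x _ => ?_
      rw [Fintype.sum_eq_single p (by intro a ha; simp [ha]),
        Fintype.sum_eq_single (x (Fin.last i)) (by intro a ha; simp [ha.symm])]
      by_cases h : x (Fin.last i) < p <;> simp [h]
    · rintro ⟨a, x⟩
      have := hsnoc i a x
      simp [Fin.snocEquiv, this]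

open PartialOrder in
/-- Strict chains of length `j` in `P` correspond to totally ordered subsets with `j + 1`
elements. -/
theorem card_chains_eq_numStrictChains (P : Type*) [PartialOrder P] (j : ℕ) :
    Nat.card {F : NonemptyFiniteChains P // F.finset.card = j + 1} = numStrictChains P j := by
  classical
  symm
  refine Nat.card_congr (Equiv.ofBijective (fun x => ⟨⟨Finset.univ.image x.1, by simp, ?_⟩, ?_⟩)
    ⟨?_, ?_⟩)
  · rintro ⟨a, ha⟩ ⟨b, hb⟩
    obtain ⟨a, -, rfl⟩ := Finset.mem_image.1 ha
    obtain ⟨b, -, rfl⟩ := Finset.mem_image.1 hb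
    exact (le_total a b).imp (fun h => x.2.monotone h) fun h => x.2.monotone h
  · rw [Finset.card_image_of_injective _ x.2.injective, Finset.card_fin]
  · rintro ⟨x, hx⟩ ⟨y, hy⟩ h
    simp only [Subtype.mk.injEq, NonemptyFiniteChains.mk.injEq] at h
    rw [Subtype.mk.injEq, ← hx.range_inj hy]
    simpa using congrArg (fun s : Finset P => (s : Set P)) h
  · rintro ⟨F, hF⟩
    let _ : LinearOrder F.finset :=
      { (inferInstance : PartialOrder F.finset) with
        le_total := F.comparable
        toDecidableLE := Classical.decRel _ }
    let e : Fin (j + 1) ≃o F.finset := Fintype.orderIsoFinOfCardEq F.finset (by simpa using hF)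
    refine ⟨⟨fun i => (e i : P), fun a b hab => e.strictMono hab⟩, ?_⟩
    apply Subtype.ext
    apply NonemptyFiniteChains.ext
    ext p
    simp only [Finset.mem_image, Finset.mem_univ, true_and]
    exact ⟨fun ⟨i, hi⟩ => hi ▸ (e i).2, fun hp => ⟨e.symm ⟨p, hp⟩, by simp⟩⟩

open PartialOrder in
/-- Barycentric subdivision acts on `f`-polynomials by `subdiv`. -/
theorem coeff_succ_subdiv_fPoly (P : Type*) [PartialOrder P] [Finite P] [Nonempty P] (i : ℕ) :
    (subdiv (fPoly P)).coeff (i + 1) = numStrictChains (NonemptyFiniteChains P) i := by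
  classical
  have := Fintype.ofFinite P
  have : Finite (NonemptyFiniteChains P) :=
    Finite.of_injective NonemptyFiniteChains.finset fun _ _ h => NonemptyFiniteChains.ext h
  have := Fintype.ofFinite (NonemptyFiniteChains P)
  obtain ⟨c, hc, hc0, hcs⟩ := exists_strictChainsTo (NonemptyFiniteChains P)
  have hcard0 : ∀ F : NonemptyFiniteChains P, F.finset.card ≠ 0 := fun F =>
    Finset.card_ne_zero.2 F.nonempty
  -- Every nonempty subset of a chain is a chain, so the elements below `F` are its nonempty proper
  -- subsets; `φ 0 = 0` lets the empty set join the sum.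
  have hsub : ∀ (F : NonemptyFiniteChains P) (φ : ℕ → ℝ), φ 0 = 0 →
      ∑ G : NonemptyFiniteChains P, (if G < F then 1 else 0) * φ G.finset.card =
        ∑ m ∈ Finset.range F.finset.card, F.finset.card.choose m * φ m := by
    intro F φ hφ
    have h1 : ∑ m ∈ Finset.range F.finset.card, (F.finset.card.choose m : ℝ) * φ m =
        ∑ s ∈ F.finset.ssubsets, φ s.card := by
      rw [← add_left_inj (φ F.finset.card), Finset.ssubsets, Finset.sum_erase_add _ _ (by simp),
        Finset.sum_powerset_apply_card, Finset.sum_range_succ]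
      simp
    rw [h1]
    simp only [ite_mul, one_mul, zero_mul]
    rw [← Finset.sum_filter, ← Finset.sum_filter_of_ne (s := F.finset.ssubsets)
      (p := fun s => s.Nonempty)]
    · refine Finset.sum_bij (fun G _ => G.finset) ?_ ?_ ?_ ?_
      · intro G hG
        simpa using hG
      · intro G _ G' _ h
        exact NonemptyFiniteChains.ext h
      · intro s hs
        simp only [Finset.mem_filter, Finset.mem_ssubsets] at hs
        exact ⟨⟨s, hs.2, fun a b => F.comparable ⟨a, hs.1.1 a.2⟩ ⟨b, hs.1.1 b.2⟩⟩,
          by simpa using hs.1, rfl⟩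
      · intros; rfl
    · intro s _ hs
      rw [Finset.nonempty_iff_ne_empty]
      rintro rfl
      exact hs (by simpa using hφ)
  -- The number of strict chains ending at `F` depends only on the size of `F`: summing over the
  -- next to last member gives the recursion `geomPoly_eq_sum`.
  have hto : ∀ i F, c F i = (geomPoly F.finset.card).coeff (i + 1) := by
    intro i
    induction i with
    | zero =>
      intro F
      rw [hc0]
      obtain ⟨n, hn⟩ := Nat.exists_eq_succ_of_ne_zero (hcard0 F)
      rw [hn]
      exact (coeff_geomPoly_succ_one n).symm
    | succ i ih =>
      intro F
      rw [hcs, geomPoly_eq_sum (hcard0 F), coeff_X_mul, finsetSum_coeff]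
      simp_rw [ih, coeff_C_mul]
      refine hsub F (fun n => (geomPoly n).coeff (i + 1)) ?_
      simp [geomPoly_zero, coeff_one]
  have hle : ∀ F : NonemptyFiniteChains P, F.finset.card ≤ posetDim P + 1 := by
    intro F
    by_contra h
    obtain ⟨j, hj⟩ := Nat.exists_eq_succ_of_ne_zero (hcard0 F)
    have h0 := card_chains_eq_numStrictChains P j
    rw [numStrictChains_eq_zero (by omega), Nat.card_eq_zero] at h0
    exact h0.elim (fun h => h.elim ⟨F, hj⟩) fun h => (not_finite_iff_infinite.2 h) inferInstance
  rw [hc, coeff_subdiv (N := posetDim P + 2) (by rw [natDegree_fPoly]; omega)]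
  simp_rw [hto]
  -- Group the top members `F` by size; the number of each size is a coefficient of `fPoly P`.
  rw [← Finset.sum_fiberwise_of_maps_to (t := Finset.range (posetDim P + 2))
    (g := fun F : NonemptyFiniteChains P => F.finset.card)
    (fun F _ => Finset.mem_range.2 (Nat.lt_succ_of_le (hle F)))]
  refine Finset.sum_congr rfl fun n _ => ?_
  rw [Finset.sum_congr rfl fun F hF => by rw [(Finset.mem_filter.1 hF).2], Finset.sum_const,
    nsmul_eq_mul]
  congr 1
  cases n with
  | zero =>
    rw [coeff_fPoly_zero, Finset.filter_false_of_mem fun F _ => hcard0 F]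
    simp
  | succ j =>
    rw [coeff_fPoly_succ, ← card_chains_eq_numStrictChains, Nat.card_eq_fintype_card,
      Fintype.card_subtype]

theorem nonempty_Sd (P : FinPartOrd) [Nonempty P] : Nonempty (Sd P) :=
  (‹Nonempty P›).map fun p => (⟨{p}, by simp, by
    rintro ⟨a, ha⟩ ⟨b, hb⟩
    rw [Finset.mem_singleton] at ha hb
    subst ha hb
    exact .inl le_rfl⟩ : PartialOrder.NonemptyFiniteChains P)

theorem fPoly_Sd (P : FinPartOrd) [Nonempty P] : fPoly (Sd P) = subdiv (fPoly P) := by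
  have := nonempty_Sd P
  ext m
  cases m with
  | zero => rw [coeff_fPoly_zero, coeff_subdiv_zero, coeff_fPoly_zero]
  | succ i =>
    rw [coeff_fPoly_succ, coeff_succ_subdiv_fPoly]
    rfl

end Chains

/-! ### The zeta function as a fraction over a power of `1 - s`. -/

section ZetaNumerator

open Polynomial

theorem coeff_one_sub_X_pow (e m : ℕ) :
    ((1 - X : ℝ[X]) ^ e).coeff m = (-1) ^ m * (e.choose m : ℝ) := by
  have h : (1 - X : ℝ[X]) ^ e = ((1 + X) ^ e).comp (C (-1) * X) := by
    simp [pow_comp, sub_eq_add_neg]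
  rw [h, comp_C_mul_X_coeff, coeff_one_add_X_pow, mul_comm]

/-- The polynomial `∑ j, g_{j+1} X ^ j (1 - X) ^ (d - j)`. -/
noncomputable def zetaNumer (d : ℕ) (g : ℝ[X]) : ℝ[X] :=
  ∑ j ∈ Finset.range (d + 1), C (g.coeff (j + 1)) * (X ^ j * (1 - X) ^ (d - j))

theorem coeff_zetaNumer (d : ℕ) (g : ℝ[X]) (m : ℕ) : (zetaNumer d g).coeff m =
    ∑ j ∈ Finset.range (d + 1), g.coeff (j + 1) *
      (X ^ j * (1 - X) ^ (d - j) : ℝ[X]).coeff m := by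
  simp [zetaNumer, finsetSum_coeff]

theorem natDegree_zetaNumer_le (d : ℕ) (g : ℝ[X]) : (zetaNumer d g).natDegree ≤ d := by
  refine natDegree_sum_le_of_forall_le _ _ fun j hj => (natDegree_C_mul_le _ _).trans ?_
  have h1 : ((1 - X : ℝ[X]) ^ (d - j)).natDegree ≤ (d - j) * 1 :=
    natDegree_pow_le_of_le _ ((natDegree_sub_le _ _).trans (by simp))
  refine (natDegree_mul_le_of_le (natDegree_X_pow_le j) h1).trans ?_
  rw [Finset.mem_range] at hj
  omega

theorem coeff_zero_zetaNumer (d : ℕ) (g : ℝ[X]) : (zetaNumer d g).coeff 0 = g.coeff 1 := by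
  rw [coeff_zetaNumer, Finset.sum_eq_single 0]
  · simp [coeff_one_sub_X_pow]
  · intro j _ hj
    rw [coeff_X_pow_mul', if_neg (by omega), mul_zero]
  · simp

/-- Only the term `j = d` survives at `1`. For an `f`-polynomial the value is nonzero, which
excludes cancellation against the denominator. -/
theorem eval_one_zetaNumer (d : ℕ) (g : ℝ[X]) : (zetaNumer d g).eval 1 = g.coeff (d + 1) := by
  rw [zetaNumer, eval_finsetSum, Finset.sum_range_succ, Finset.sum_eq_zero]
  · simp
  · intro j hj
    have : d - j ≠ 0 := by rw [Finset.mem_range] at hj; omega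
    simp [this]

theorem eval_neg_one_eq_sum {d : ℕ} {g : ℝ[X]} (hg : g.natDegree ≤ d + 1) (h0 : g.coeff 0 = 0) :
    g.eval (-1) = ∑ j ∈ Finset.range (d + 1), g.coeff (j + 1) * (-1) ^ (j + 1) := by
  rw [eval_eq_sum_range' (Nat.lt_succ_of_le hg), Finset.sum_range_succ', h0]
  simp

/-- `X ^ j * (1 - X) ^ (d - j)` has top coefficient `(-1) ^ (d - j)`, so the alternating sum `g(-1)`
appears. -/
theorem coeff_zetaNumer_self {d : ℕ} {g : ℝ[X]} (hg : g.natDegree ≤ d + 1)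
    (h0 : g.coeff 0 = 0) : (zetaNumer d g).coeff d = (-1) ^ (d + 1) * g.eval (-1) := by
  rw [coeff_zetaNumer, eval_neg_one_eq_sum hg h0, Finset.mul_sum]
  refine Finset.sum_congr rfl fun j hj => ?_
  obtain ⟨r, rfl⟩ := Nat.exists_eq_add_of_le (Nat.lt_succ_iff.1 (Finset.mem_range.1 hj))
  rw [coeff_X_pow_mul', if_pos (by omega), Nat.add_sub_cancel_left, coeff_one_sub_X_pow,
    Nat.choose_self, show j + r + 1 = (j + 1) + r by ring, pow_add _ (j + 1) r]
  have : ((-1 : ℝ) ^ (j + 1)) * (-1) ^ (j + 1) = 1 := by rw [← mul_pow]; simp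
  linear_combination (-(g.coeff (j + 1) * (-1) ^ r)) * this

/-- The `j`-th term contributes with weight `d - j` up to sign. Writing this as `(d + 1) - (j + 1)`
separates `g(-1)` from `g'(-1)`. -/
theorem coeff_zetaNumer_pred {d : ℕ} (hd : 1 ≤ d) {g : ℝ[X]} (hg : g.natDegree ≤ d + 1)
    (h0 : g.coeff 0 = 0) : (zetaNumer d g).coeff (d - 1) =
      (-1) ^ d * ((derivative g).eval (-1) + (d + 1) * g.eval (-1)) := by
  have hder : (derivative g).natDegree < d + 1 := (natDegree_derivative_le g).trans_lt (by omega)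
  rw [coeff_zetaNumer, eval_neg_one_eq_sum hg h0, eval_eq_sum_range' hder, Finset.mul_sum,
    ← Finset.sum_add_distrib, Finset.mul_sum]
  refine Finset.sum_congr rfl fun j hj => ?_
  obtain ⟨r, rfl⟩ := Nat.exists_eq_add_of_le (Nat.lt_succ_iff.1 (Finset.mem_range.1 hj))
  have hsq : ((-1 : ℝ) ^ j) * (-1) ^ j = 1 := by rw [← mul_pow]; simp
  rw [coeff_X_pow_mul', Nat.add_sub_cancel_left, coeff_derivative]
  cases r with
  | zero =>
    rw [if_neg (by omega)]
    push_cast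
    ring
  | succ r =>
    rw [if_pos (by omega), show j + (r + 1) - 1 - j = r by omega, coeff_one_sub_X_pow,
      Nat.choose_succ_self_right]
    push_cast
    rw [pow_add (-1 : ℝ) j (r + 1)]
    linear_combination (-(g.coeff (j + 1) * (-1) ^ r * (r + 1))) * hsq

theorem eq_pow_mulVec {ι : Type*} [Fintype ι] [DecidableEq ι] (B : Matrix ι ι ℂ)
    (c : ι → ℕ → ℂ) (h0 : ∀ p, c p 0 = 1) (hs : ∀ p i, c p (i + 1) = ∑ q, B p q * c q i) (i : ℕ) :
    (fun p => c p i) = (B ^ i).mulVec 1 := by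
  induction i with
  | zero => ext p; simp [h0]
  | succ i ih =>
    rw [pow_succ', ← Matrix.mulVec_mulVec, ← ih]
    ext p
    exact hs p i

/-- Weak chains are strict chains with repetitions. -/
theorem numChains_eq_sum (P : Type*) [PartialOrder P] [Finite P] (i : ℕ) :
    (numChains P i : ℂ) = ∑ j ∈ Finset.range (i + 1), (i.choose j : ℂ) * numStrictChains P j := by
  classical
  have := Fintype.ofFinite P
  obtain ⟨c, hc, hc0, hcs⟩ := exists_chainsFrom P
  obtain ⟨s, hs, hs0, hss⟩ := exists_strictChainsTo P
  set A : Matrix P P ℂ := Matrix.of fun p q => if p ≤ q then 1 else 0 with hA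
  set N : Matrix P P ℂ := Matrix.of fun p q => if q < p then 1 else 0 with hN
  have h1 := fun i => eq_pow_mulVec A c hc0 (fun p i => by rw [hcs]; congr! 2) i
  have h2 := fun i => eq_pow_mulVec N (fun p i => (s p i : ℂ)) (by simp [hs0])
    (fun p i => by
      rw [hss]
      push_cast
      exact Finset.sum_congr rfl fun q _ => by by_cases h : q < p <;> simp [hN, h]) i
  -- Weak chains are indexed by their first term and strict ones by their last, hence the transpose,
  -- which leaves the sum of all entries unchanged. The binomial expansion of `(N + 1) ^ i` then
  -- gives the formula.
  have hAN : A.transpose = N + 1 := by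
    ext p q
    simp only [hA, hN, Matrix.transpose_apply, Matrix.of_apply, Matrix.add_apply,
      Matrix.one_apply, le_iff_lt_or_eq]
    by_cases h : q = p
    · subst h; simp
    · simp [h, Ne.symm h]
  have hsum : ∀ v : P → ℂ, ∑ p, v p = dotProduct 1 v := fun v => by simp [dotProduct]
  have hs' : ∀ j, (numStrictChains P j : ℂ) = dotProduct 1 ((N ^ j).mulVec 1) := fun j => by
    rw [← h2, ← hsum, ← Complex.ofReal_sum, ← hs]
    simp
  rw [hc, hsum, h1, Matrix.dotProduct_mulVec, ← Matrix.mulVec_transpose, dotProduct_comm,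
    Matrix.transpose_pow, hAN, (Commute.one_right N).add_pow, Matrix.sum_mulVec, dotProduct_sum]
  refine Finset.sum_congr rfl fun j _ => ?_
  rw [hs', one_pow, mul_one, ← Nat.cast_comm, ← nsmul_eq_mul, Matrix.smul_mulVec, dotProduct_smul,
    nsmul_eq_mul]

/-- The negative binomial series, shifted by `j` because `i.choose j` vanishes for `i < j`. -/
theorem mk_choose_mul_one_sub_pow (j : ℕ) :
    (PowerSeries.mk fun i => (i.choose j : ℂ)) * (1 - PowerSeries.X) ^ (j + 1) =
      PowerSeries.X ^ j := by
  have h : (PowerSeries.mk fun i => (i.choose j : ℂ)) =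
      PowerSeries.X ^ j * PowerSeries.mk fun n => ((j + n).choose j : ℂ) := by
    ext i
    rw [PowerSeries.coeff_mk, PowerSeries.coeff_X_pow_mul']
    split_ifs with hi
    · rw [PowerSeries.coeff_mk, Nat.add_sub_cancel' hi]
    · rw [Nat.choose_eq_zero_of_lt (by omega), Nat.cast_zero]
  rw [h, mul_assoc, PowerSeries.mk_add_choose_mul_one_sub_pow_eq_one, mul_one]

theorem zetaSeries_mul_one_sub_pow (P : Type*) [PartialOrder P] [Finite P] [Nonempty P] :
    zetaSeries P * (1 - PowerSeries.X) ^ (posetDim P + 1) =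
      (((zetaNumer (posetDim P) (fPoly P)).map (algebraMap ℝ ℂ) : ℂ[X]) : PowerSeries ℂ) := by
  have h : zetaSeries P = ∑ j ∈ Finset.range (posetDim P + 1),
      PowerSeries.C (numStrictChains P j : ℂ) * PowerSeries.mk fun i => (i.choose j : ℂ) := by
    ext i
    simp only [zetaSeries, PowerSeries.coeff_mk, map_sum, PowerSeries.coeff_C_mul,
      numChains_eq_sum]
    -- Extend both sums to a common range: the added terms vanish through the binomial coefficient
    -- on one side and through the dimension on the other.
    rw [Finset.sum_subset (Finset.range_mono (Nat.le_add_right (i + 1) (posetDim P))),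
      ← Finset.sum_subset (s₁ := Finset.range (posetDim P + 1))
        (s₂ := Finset.range (i + 1 + posetDim P)) (Finset.range_mono (by omega))]
    · exact Finset.sum_congr rfl fun j _ => mul_comm _ _
    · intro j _ hj
      rw [Finset.mem_range, not_lt] at hj
      rw [numStrictChains_eq_zero (by omega), Nat.cast_zero, mul_zero]
    · intro j _ hj
      rw [Finset.mem_range, not_lt] at hj
      rw [Nat.choose_eq_zero_of_lt (by omega), Nat.cast_zero, zero_mul]
  rw [h, Finset.sum_mul, zetaNumer, Polynomial.map_sum, ← coeToPowerSeries.ringHom_apply, map_sum]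
  refine Finset.sum_congr rfl fun j hj => ?_
  rw [Finset.mem_range] at hj
  rw [show posetDim P + 1 = (j + 1) + (posetDim P - j) by omega, pow_add, mul_assoc,
    ← mul_assoc (PowerSeries.mk _), mk_choose_mul_one_sub_pow, coeff_fPoly_succ, Polynomial.map_mul, map_C,
    map_natCast (algebraMap ℝ ℂ), coeToPowerSeries.ringHom_apply, coe_mul, coe_C]
  congr 1
  simp

open scoped RatFunc in
/-- The zeros of the zeta function are the roots of the numerator over `(1 - s) ^ (d + 1)`. -/
theorem zetaZeros_eq_roots (P : Type*) [PartialOrder P] [Finite P] [Nonempty P] :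
    zetaZeros P = ((zetaNumer (posetDim P) (fPoly P)).map (algebraMap ℝ ℂ)).roots := by
  set n : ℂ[X] := (zetaNumer (posetDim P) (fPoly P)).map (algebraMap ℝ ℂ) with hn
  set b : ℂ[X] := (1 - X) ^ (posetDim P + 1) with hb
  set Z := zetaFunction P with hZ
  have hφ : ∀ p : ℂ[X], algebraMap (RatFunc ℂ) (LaurentSeries ℂ) (algebraMap ℂ[X] (RatFunc ℂ) p) =
      ((p : PowerSeries ℂ) : LaurentSeries ℂ) := fun p => (RatFunc.coe_coe p).symm
  have h1 : Z * algebraMap ℂ[X] (RatFunc ℂ) b = algebraMap ℂ[X] (RatFunc ℂ) n := by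
    apply (algebraMap (RatFunc ℂ) (LaurentSeries ℂ)).injective
    rw [map_mul, hφ, hφ, hn, ← zetaSeries_mul_one_sub_pow]
    have h2 : algebraMap (RatFunc ℂ) (LaurentSeries ℂ) Z = (zetaSeries P : LaurentSeries ℂ) :=
      coe_zetaFunction P
    rw [h2, hb, ← map_mul]
    congr 2
    simp
  have h2 : Z.num * b = n * Z.denom := by
    apply RatFunc.algebraMap_injective ℂ
    rw [map_mul, map_mul, ← h1]
    have hZd := RatFunc.num_div_denom Z
    have : algebraMap ℂ[X] (RatFunc ℂ) Z.denom ≠ 0 := RatFunc.algebraMap_ne_zero Z.denom_ne_zero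
    rw [div_eq_iff this] at hZd
    rw [hZd]
    ring
  have hn1 : n.eval 1 ≠ 0 := by
    rw [hn, ← map_one (algebraMap ℝ ℂ), eval_map_apply, eval_one_zetaNumer,
      coeff_fPoly_succ]
    simpa using (isGreatest_posetDim P).1
  have hcop : IsCoprime n b := by
    apply IsCoprime.pow_right
    have : IsCoprime (X - C 1) n := by
      rw [(irreducible_X_sub_C (1 : ℂ)).coprime_iff_not_dvd, dvd_iff_isRoot]
      exact hn1
    simpa using this.symm.neg_right
  -- Both fractions are in lowest terms, so their numerators divide each other and differ by a
  -- nonzero constant.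
  have hd1 : Z.num ∣ n := (RatFunc.isCoprime_num_denom Z).dvd_of_dvd_mul_right ⟨b, h2.symm⟩
  have hd2 : n ∣ Z.num := hcop.dvd_of_dvd_mul_right ⟨Z.denom, h2⟩
  obtain ⟨u, hu⟩ := associated_of_dvd_dvd hd1 hd2
  obtain ⟨a, ha, hau⟩ := Polynomial.isUnit_iff.1 u.isUnit
  rw [zetaZeros, ← hZ, ← hu, ← hau, mul_comm, roots_C_mul _ ha.ne_zero]

end ZetaNumerator

/-! ### The limiting numerator. -/

section LimitPolynomial

open Polynomial

/-- The values of a symmetric eigenvector of `subdiv` that determine the extreme coefficients of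
the limiting numerator. -/
theorem eigenvector_values {d : ℕ} (hd : 1 ≤ d) {v : ℝ[X]} (hv : v.natDegree ≤ d + 1)
    (hLv : subdiv v = C ((d + 1).factorial : ℝ) * v) (hnonneg : ∀ m, 0 ≤ v.coeff m)
    (hpos : 0 < v.coeff (d + 1)) :
    v.coeff 0 = 0 ∧ 0 < v.coeff 1 ∧ v.eval (-1) = 0 ∧
      (derivative v).eval (-1) = (-1) ^ d * v.coeff 1 := by
  have hlam : (1 : ℝ) < ((d + 1).factorial : ℝ) := by
    exact_mod_cast Nat.one_lt_factorial.2 (by omega)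
  -- A functional preserved by `subdiv` is also scaled by `(d + 1)! > 1` on `v`, so it vanishes
  -- there. This handles the values at `0` and at `-1`.
  have hfix : ∀ x : ℝ, x = (d + 1).factorial * x → x = 0 := fun x hx => by
    have : ((d + 1).factorial - 1 : ℝ) * x = 0 := by linarith
    exact (mul_eq_zero.1 this).resolve_left (by linarith)
  refine ⟨?_, ?_, ?_, ?_⟩
  · apply hfix
    rw [← coeff_C_mul, ← hLv, coeff_subdiv_zero]
  · have h : 0 < ((d + 1).factorial : ℝ) * v.coeff 1 := by
      rw [← coeff_C_mul, ← hLv, coeff_subdiv (Nat.lt_succ_of_le hv)]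
      refine Finset.sum_pos' (fun n _ => mul_nonneg (hnonneg n) (coeff_geomPoly_nonneg n 1))
        ⟨d + 1, by simp, ?_⟩
      rw [coeff_geomPoly_succ_one, mul_one]
      exact hpos
    exact pos_of_mul_pos_right h (by positivity)
  · apply hfix
    have := congrArg (eval (-1)) hLv
    rwa [eval_neg_one_subdiv, eval_mul, eval_C] at this
  -- Differentiate the symmetry `v(-1 - X) = (-1) ^ (d + 1) v(X)` at `0`.
  · have h := congrArg (fun p => (derivative p).eval 0) (comp_eq_of_subdiv_eq (by omega) hv hLv)
    have hc : ((-1 : ℝ[X]) ^ (d + 1)) = C ((-1) ^ (d + 1)) := by simp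
    simp only [hc, derivative_comp, derivative_C_mul, eval_mul, eval_comp, derivative_sub,
      derivative_neg, derivative_one, derivative_X, eval_C, eval_sub, eval_neg, eval_one, eval_X,
      neg_zero, zero_sub, sub_zero] at h
    rw [← coeff_zero_eq_eval_zero, coeff_derivative, pow_succ] at h
    norm_num at h
    linarith

/-- The zeros of the zeta functions of the iterated subdivisions are the roots of polynomials of
degree `d` that converge to a polynomial of degree `d - 1` whose constant and leading coefficients
agree. -/
theorem exists_numerators_iterate_Sd (P : Type*) [PartialOrder P] [Fintype P] (d : ℕ)
    (hd : posetDim P = d) (hd1 : 1 ≤ d) (hχ : eulerChar P ≠ 0) :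
    ∃ (q : ℕ → ℝ[X]) (l : ℕ → ℝ), (∀ k, (q k).natDegree = d) ∧
      (∀ k, zetaZeros (Sd^[k] (FinPartOrd.of P)) = ((q k).map (algebraMap ℝ ℂ)).roots) ∧
      (∀ m, Tendsto (fun k => (q k).coeff m) atTop (𝓝 (l m))) ∧
      l d = 0 ∧ l 0 ≠ 0 ∧ l (d - 1) = l 0 := by
  have := nonempty_of_posetDim_ne_zero (P := P) (by omega)
  set Q : ℕ → FinPartOrd := fun k => Sd^[k] (FinPartOrd.of P) with hQ
  have hQs : ∀ k, Q (k + 1) = Sd (Q k) := fun k => Function.iterate_succ_apply' Sd k _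
  have hne : ∀ k, Nonempty (Q k) := fun k => by
    induction k with
    | zero => exact this
    | succ k ih => rw [hQs]; exact nonempty_Sd _
  set g : ℕ → ℝ[X] := fun k => fPoly (Q k) with hg
  have hgs : ∀ k, g (k + 1) = subdiv (g k) := fun k => by
    simp only [hg]
    rw [hQs, fPoly_Sd]
  have hgd : ∀ k, (g k).natDegree = d + 1 := fun k => by
    induction k with
    | zero => rw [← hd]; exact natDegree_fPoly P
    | succ k ih => rw [hgs, natDegree_subdiv, ih]
  have hdim : ∀ k, posetDim (Q k) = d := fun k => by
    have := hgd k
    rw [hg, natDegree_fPoly] at this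
    omega
  have hg0 : ∀ k, (g k).coeff 0 = 0 := fun k => coeff_fPoly_zero _
  have hgχ : ∀ k, (g k).eval (-1) ≠ 0 := fun k => by
    induction k with
    | zero =>
      have h : (g 0).eval (-1) = -(eulerChar P : ℝ) := eval_neg_one_fPoly P
      rw [h]
      exact neg_ne_zero.2 (by exact_mod_cast hχ)
    | succ k ih => rwa [hgs, eval_neg_one_subdiv]
  set n : ℕ → ℝ[X] := fun k => zetaNumer d (g k) with hn
  have hnd : ∀ k, (n k).natDegree = d := fun k => by
    refine natDegree_eq_of_le_of_coeff_ne_zero (natDegree_zetaNumer_le _ _) ?_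
    rw [hn, coeff_zetaNumer_self (hgd k).le (hg0 k)]
    exact mul_ne_zero (pow_ne_zero _ (by norm_num)) (hgχ k)
  have hzeros : ∀ k, zetaZeros (Q k) = ((n k).map (algebraMap ℝ ℂ)).roots := fun k => by
    rw [zetaZeros_eq_roots, hdim]
  obtain ⟨v, hvd, hvD, hLv, hvlim⟩ := exists_limit_subdiv (D := d + 1) (by omega) g
    (fun k => (hgd k).le) hgs
  have hlam : ∀ k, ((d + 1).factorial : ℝ) ^ k ≠ 0 := fun k =>
    pow_ne_zero _ (by exact_mod_cast Nat.factorial_ne_zero _)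
  have hgnonneg : ∀ k m, 0 ≤ (g k).coeff m := fun k m => by
    cases m with
    | zero => rw [hg0]
    | succ m =>
      rw [hg, coeff_fPoly_succ]
      positivity
  obtain ⟨hv0, hv1, hvχ, hvder⟩ := eigenvector_values hd1 hvd hLv
    (fun m => ge_of_tendsto' (hvlim m) fun k => div_nonneg (hgnonneg k m) (by positivity))
    (by
      rw [hvD]
      refine (hgnonneg 0 (d + 1)).lt_of_ne' ?_
      rw [← hgd 0]
      exact leadingCoeff_ne_zero.2 fun h => by simpa [h] using hgd 0)
  have hpred : (zetaNumer d v).coeff (d - 1) = v.coeff 1 := by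
    rw [coeff_zetaNumer_pred hd1 hvd hv0, hvχ, hvder, mul_zero, add_zero, ← mul_assoc, ← mul_pow]
    simp
  -- Dividing the numerators by `(d + 1)! ^ k` keeps their roots and makes their coefficients
  -- converge.
  refine ⟨fun k => C (((d + 1).factorial : ℝ) ^ k)⁻¹ * n k, fun m => (zetaNumer d v).coeff m,
    fun k => ?_, fun k => ?_, fun m => ?_, ?_, ?_, ?_⟩ <;> beta_reduce
  · rw [natDegree_C_mul (inv_ne_zero (hlam k)), hnd]
  · rw [Polynomial.map_mul, map_C, roots_C_mul]
    · exact hzeros k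
    · exact (_root_.map_ne_zero _).2 (inv_ne_zero (hlam k))
  · rw [coeff_zetaNumer]
    refine (tendsto_finsetSum _ fun j _ => (hvlim (j + 1)).mul_const _).congr fun k => ?_
    rw [coeff_C_mul, hn, coeff_zetaNumer, Finset.mul_sum]
    exact Finset.sum_congr rfl fun j _ => by ring
  · rw [coeff_zetaNumer_self hvd hv0, hvχ, mul_zero]
  · rw [coeff_zero_zetaNumer]
    exact hv1.ne'
  · rw [coeff_zero_zetaNumer, hpred]

end LimitPolynomial

/-! ### Zeros for iterated subdivisions. -/

theorem theorem1p1 (P : Type*) [PartialOrder P] [Fintype P] (d : ℕ) (hd : posetDim P = d)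
    (hd1 : 1 ≤ d) (hχ : eulerChar P ≠ 0) :
    -- For every `k`, the zeta series of `Sd^k(P)` has exactly `d` zeros, with multiplicity.
    (∀ k, (zetaZeros (Sd^[k] (FinPartOrd.of P))).card = d) ∧
    -- Let `β k 1, …, β k d` be any enumeration of them with `β k 1` of maximal modulus.
    ∀ β : ℕ → ℕ → ℂ,
      (∀ k, (Finset.Icc 1 d).val.map (β k) = zetaZeros (Sd^[k] (FinPartOrd.of P))) →
      (∀ k, ∀ i ∈ Finset.Icc 1 d, ‖β k i‖ ≤ ‖β k 1‖) →
      Tendsto (fun k => ‖β k 1‖) atTop atTop ∧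
      -- After a reordering of `β k 2, …, β k d` for each `k`, each of these sequences converges.
      (∃ σ : ℕ → Equiv.Perm ℕ, (∀ k, ∀ i ∉ Finset.Icc 2 d, σ k i = i) ∧
        ∀ i ∈ Finset.Icc 2 d, ∃ α : ℂ, Tendsto (fun k => β k (σ k i)) atTop (𝓝 α)) ∧
      (∀ᶠ k in atTop, (β k 1).im = 0) ∧
      Tendsto (fun k => ∏ i ∈ Finset.Icc 2 d, β k i) atTop (𝓝 ((-1) ^ (d - 1))) := by
  obtain ⟨q, l, hqd, hq, hl, hld, hl0, hpred⟩ := exists_numerators_iterate_Sd P d hd hd1 hχ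
  refine ⟨fun k => ?_, fun β hβ hmax => ?_⟩
  · have h := (IsAlgClosed.splits ((q k).map (algebraMap ℝ ℂ))).natDegree_eq_card_roots
    rw [Polynomial.natDegree_map_eq_of_injective (algebraMap ℝ ℂ).injective, hqd] at h
    rw [hq, ← h]
  · have key := roots_of_tendsto_degree_drop hd1 q l hqd hl hld hl0 (hpred ▸ hl0) β
      (fun k => (hβ k).trans (hq k)) hmax
    rwa [hpred, div_self hl0, Complex.ofReal_one, mul_one] at key
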